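/- Let $f:\mathbb{R}\to\mathbb{R}$ be integrable, with characteristic function $\varphi(u)=\int_{\mathbb{R}} f(x)e^{iux}\,dx$. Suppose that $\varphi$ has a weak derivative $\varphi'$ on $\mathbb{R}$, that is, $\varphi':\mathbb{R}\to\mathbb{C}$ is locally integrable and $\int_{\mathbb{R}}\varphi(u) g'(u)\,du=-\int_{\mathbb{R}}\varphi'(u)g(u)\,du$ for every $g\in C_c^\infty(\mathbb{R};\mathbb{C})$, and that $|\varphi|^2+|\varphi'|^2$ is integrable on $\mathbb{R}$. Then the functions $f$ and $x\mapsto x f(x)$ are square integrable on $\mathbb{R}$, and $f$ is COS-admissible, that is, $$B(L):=\sum_{k=0}^{\infty}\frac1L\left|\int_{\mathbb{R}\setminus[-L,L]} f(x)\cos\left(k\pi\,\frac{x+L}{2L}\right)dx\right|^2\longrightarrow 0\qquad\text{as } L\to\infty .$$ -/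

import Mathlib

open MeasureTheory Filter Topology
open scoped ENNReal ContDiff

/-- The characteristic function `φ(u) = ∫ f(x) e^{iux} dx` of an integrable function
`f : ℝ → ℝ`. -/
noncomputable def characteristicFunction (f : ℝ → ℝ) (u : ℝ) : ℂ :=
  ∫ x : ℝ, (f x : ℂ) * Complex.exp (Complex.I * (u : ℂ) * (x : ℂ))

/-- `ψ` is a weak derivative of `φ` on `ℝ`: both functions are locally integrable and
`∫ φ g' = - ∫ ψ g` for every test function `g ∈ C_c^∞(ℝ)`. -/
def IsWeakDerivative (φ ψ : ℝ → ℂ) : Prop :=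
  LocallyIntegrable φ volume ∧ LocallyIntegrable ψ volume ∧
    ∀ g : ℝ → ℂ, ContDiff ℝ ∞ g → HasCompactSupport g →
      ∫ u : ℝ, φ u * deriv g u = -∫ u : ℝ, ψ u * g u

/-- `B(L) = ∑_{k ≥ 0} (1/L) |∫_{ℝ \ [-L, L]} f(x) cos(kπ (x + L) / (2L)) dx|²`, as an element of
`[0, ∞]`; it is only meaningful for `L > 0`. -/
noncomputable def cosTail (f : ℝ → ℝ) (L : ℝ) : ℝ≥0∞ :=
  ∑' k : ℕ, ENNReal.ofReal
    (1 / L * |∫ x in (Set.Icc (-L) L)ᶜ, f x * Real.cos (k * Real.pi * ((x + L) / (2 * L)))| ^ 2)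

/-- A function `f : ℝ → ℝ` is COS-admissible if it is integrable and `B(L) → 0` as `L → ∞`. -/
def COSAdmissible (f : ℝ → ℝ) : Prop :=
  Integrable f volume ∧ Tendsto (cosTail f) atTop (𝓝 0)

/-! By Plancherel, φ in L² forces f in L². Since differentiating φ corresponds to multiplying f by
ix, φ' in L² forces x f in L². Both follow by duality with Schwartz functions, using
`memLp_two_of_integral_eq_integral_fourier`.

For the tail, let a_k be the cosine integrals over |x| > L and T = ∑ a_k cos_k a finite sum. Then ∑
a_k² = ∫ f T = ∫ (x f)(T / x) over the tail. The cosines are orthogonal on every translate of [-L,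
L] by 2nL, where |x| ≥ |n| L, so ∫ T² / x² is at most a constant times ∑ a_k² / L, the constant
coming from ∑ 1/n². A weighted Young inequality absorbs this term into the left side, and B(L) =
O(L⁻²) results (`cosTail_le`). -/

open FourierTransform SchwartzMap

/-! ### Square integrability by duality -/

/-- A locally integrable function that pairs with Schwartz functions like the Fourier transform of
an `L²` function is itself square integrable. -/
theorem memLp_two_of_integral_eq_integral_fourier {G Φ : ℝ → ℂ}
    (hG : LocallyIntegrable G volume) (hΦ : MemLp Φ 2 volume)
    (h : ∀ ψ : 𝓢(ℝ, ℂ), ∫ x, ψ x * G x = ∫ v, 𝓕 (ψ : ℝ → ℂ) v * Φ v) :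
    MemLp G 2 volume := by
  set H : Lp ℂ 2 (volume : Measure ℝ) := 𝓕 (hΦ.toLp Φ) with hH
  refine (memLp_congr_ae ?_).1 (Lp.memLp H)
  refine ae_eq_of_integral_contDiff_smul_eq
    ((Lp.memLp H).locallyIntegrable (by norm_num)) hG fun g hg hgc => ?_
  have hg₁ : HasCompactSupport (Complex.ofRealCLM ∘ g) := hgc.comp_left rfl
  have hg₂ : ContDiff ℝ ∞ (Complex.ofRealCLM ∘ g) := by fun_prop
  set ψ : 𝓢(ℝ, ℂ) := hg₁.toSchwartzMap hg₂ with hψ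
  have hψg : ∀ x, ψ x = (g x : ℂ) := fun x => rfl
  -- The L² Fourier transform agrees with the distributional one, which acts by transposition on
  -- `ψ`.
  have key : Lp.toTemperedDistribution H ψ
      = Lp.toTemperedDistribution (hΦ.toLp Φ) (𝓕 ψ) := by
    rw [hH, ← Lp.fourier_toTemperedDistribution_eq]
    rfl
  rw [Lp.toTemperedDistribution_apply, Lp.toTemperedDistribution_apply] at key
  have e1 : ∫ x, g x • H x = ∫ x, ψ x • H x := by
    simp only [hψg, Complex.real_smul, smul_eq_mul]
  have e2 : ∫ x, g x • G x = ∫ x, ψ x * G x := by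
    simp only [hψg, Complex.real_smul]
  rw [e1, e2, key, h ψ]
  refine integral_congr_ae ?_
  filter_upwards [hΦ.coeFn_toLp] with v hv
  rw [hv, SchwartzMap.fourier_coe, smul_eq_mul]

/-! ### Weak derivatives against Schwartz functions -/

/-- Rescaling the identity that defines weak derivatives. -/
theorem integral_mul_deriv_eq_neg_comp_mul_left {φ φ' : ℝ → ℂ}
    (h : ∀ g : ℝ → ℂ, ContDiff ℝ ∞ g → HasCompactSupport g →
      ∫ u : ℝ, φ u * deriv g u = -∫ u : ℝ, φ' u * g u) {a : ℝ} (ha : 0 < a)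
    (g : ℝ → ℂ) (hg : ContDiff ℝ ∞ g) (hgc : HasCompactSupport g) :
    ∫ v : ℝ, φ (a * v) * deriv g v = -∫ v : ℝ, (a * φ' (a * v)) * g v := by
  have hgd : Differentiable ℝ g := hg.differentiable (by simp)
  have h1 := h (fun u => g (a⁻¹ * u)) (by fun_prop)
    (hgc.comp_homeomorph (Homeomorph.mulLeft₀ a⁻¹ (inv_ne_zero ha.ne')))
  have hd : deriv (fun u => g (a⁻¹ * u)) = fun u => (a⁻¹ : ℂ) * deriv g (a⁻¹ * u) := by
    funext u
    rw [deriv_comp_mul_left]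
    simp
  rw [hd] at h1
  have e1 := Measure.integral_comp_mul_left
    (fun u => φ u * ((a⁻¹ : ℂ) * deriv g (a⁻¹ * u))) a
  have e2 := Measure.integral_comp_mul_left (fun u => φ' u * g (a⁻¹ * u)) a
  simp only [inv_mul_cancel_left₀ ha.ne'] at e1 e2
  have hac : (a : ℂ) ≠ 0 := by exact_mod_cast ha.ne'
  calc ∫ v : ℝ, φ (a * v) * deriv g v
      = a * ∫ v : ℝ, φ (a * v) * ((a⁻¹ : ℂ) * deriv g v) := by
        rw [← integral_const_mul]
        congr 1; funext v; field_simp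
    _ = -(a * ∫ v : ℝ, φ' (a * v) * g v) := by
        rw [e1, e2, h1]; simp
    _ = _ := by
        rw [← integral_const_mul]
        simp only [mul_assoc]

/-- The identity that defines weak derivatives extends from test functions to Schwartz functions
when the function and its weak derivative are square integrable. -/
theorem integral_mul_deriv_eq_neg_of_schwartz {φ φ' : ℝ → ℂ}
    (hφ : MemLp φ 2 volume) (hφ' : MemLp φ' 2 volume)
    (h : ∀ g : ℝ → ℂ, ContDiff ℝ ∞ g → HasCompactSupport g →
      ∫ u : ℝ, φ u * deriv g u = -∫ u : ℝ, φ' u * g u) (g : 𝓢(ℝ, ℂ)) :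
    ∫ u : ℝ, φ u * deriv g u = -∫ u : ℝ, φ' u * g u := by
  obtain ⟨χ, -⟩ : ∃ χ : ContDiffBump (0 : ℝ), True := ⟨⟨1, 2, by norm_num, by norm_num⟩, trivial⟩
  have hχ : ContDiff ℝ ∞ χ := χ.contDiff
  have hχc : HasCompactSupport χ := χ.hasCompactSupport
  obtain ⟨C, hC⟩ := hχc.deriv.exists_bound_of_continuous (hχ.continuous_deriv (by simp))
  have hgs : ContDiff ℝ ∞ (g : ℝ → ℂ) := g.smooth ⊤
  have hgd : ∀ u, DifferentiableAt ℝ (g : ℝ → ℂ) u := fun u => g.differentiableAt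
  -- The cutoffs `χ (ε n * u)` tend to 1 pointwise, and the extra product-rule term carries a factor
  -- `ε n`, so it vanishes in the limit.
  set ε : ℕ → ℝ := fun n => 1 / ((n : ℝ) + 1) with hε
  have hε0 : ∀ n, 0 < ε n := fun n => by positivity
  have hε1 : ∀ n, ε n ≤ 1 := fun n => by
    rw [hε]; simp only
    rw [div_le_one (by positivity)]
    linarith [Nat.cast_nonneg (α := ℝ) n]
  have hεt : Tendsto ε atTop (𝓝 0) := tendsto_one_div_add_atTop_nhds_zero_nat
  set γ : ℕ → ℝ → ℂ := fun n u => (χ (ε n * u) : ℂ) * g u with hγ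
  have hγd : ∀ n u, deriv (γ n) u
      = (χ (ε n * u) : ℂ) * deriv g u + ((ε n * deriv χ (ε n * u) : ℝ) : ℂ) * g u := by
    intro n u
    have h1 : HasDerivAt (fun u : ℝ => χ (ε n * u)) (ε n * deriv χ (ε n * u)) u := by
      have := ((hχ.differentiable (by simp)).differentiableAt (x := ε n * u)).hasDerivAt
      have h2 := this.comp u ((hasDerivAt_id u).const_mul (ε n))
      simpa [mul_comm, Function.comp_def] using h2
    have := h1.ofReal_comp.mul (hgd u).hasDerivAt
    exact this.deriv.trans (add_comm _ _)
  have hid : ∀ n, ∫ u : ℝ, φ u * deriv (γ n) u = -∫ u : ℝ, φ' u * γ n u := by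
    intro n
    refine h (γ n) ?_ ?_
    · have : ContDiff ℝ ∞ (fun u : ℝ => Complex.ofRealCLM (χ (ε n * u))) := by fun_prop
      exact this.mul hgs
    · refine HasCompactSupport.mul_right ?_
      exact (hχc.comp_left (g := ((↑) : ℝ → ℂ)) Complex.ofReal_zero).comp_homeomorph
        (Homeomorph.mulLeft₀ (ε n) (hε0 n).ne')
  have hχ1 : ∀ x, ‖(χ x : ℂ)‖ ≤ 1 := fun x => by
    rw [Complex.norm_real, Real.norm_of_nonneg χ.nonneg]; exact χ.le_one
  have hχlim : ∀ u : ℝ, Tendsto (fun n => (χ (ε n * u) : ℂ)) atTop (𝓝 1) := by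
    intro u
    have h0 : Tendsto (fun n => ε n * u) atTop (𝓝 0) := by simpa using hεt.mul_const u
    have := (χ.continuous.tendsto 0).comp h0
    rw [χ.one_of_mem_closedBall (by simpa using χ.rIn_pos.le)] at this
    exact_mod_cast (Complex.continuous_ofReal.tendsto 1).comp this
  have hg2 : MemLp (g : ℝ → ℂ) 2 volume := g.memLp 2
  have hdg2 : MemLp (deriv (g : ℝ → ℂ)) 2 volume := by
    have := (derivCLM ℂ ℂ g).memLp 2 volume
    exact this
  have i1 : Integrable (fun u => φ u * deriv g u) volume := hφ.integrable_mul hdg2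
  have i2 : Integrable (fun u => φ u * g u) volume := hφ.integrable_mul hg2
  have i3 : Integrable (fun u => φ' u * g u) volume := hφ'.integrable_mul hg2
  have hχm : ∀ n, AEStronglyMeasurable (fun u : ℝ => (χ (ε n * u) : ℂ)) volume := fun n =>
    (Complex.continuous_ofReal.comp (χ.continuous.comp (by fun_prop))).aestronglyMeasurable
  have hdχm : ∀ n, AEStronglyMeasurable
      (fun u : ℝ => ((ε n * deriv χ (ε n * u) : ℝ) : ℂ)) volume := fun n =>
    (Complex.continuous_ofReal.comp (continuous_const.mul
      ((hχ.continuous_deriv (by simp)).comp (by fun_prop)))).aestronglyMeasurable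
  have hdb : ∀ n u, ‖((ε n * deriv χ (ε n * u) : ℝ) : ℂ)‖ ≤ ε n * C := by
    intro n u
    rw [Complex.norm_real, norm_mul, Real.norm_of_nonneg (hε0 n).le]
    exact mul_le_mul_of_nonneg_left (hC _) (hε0 n).le
  have hC0 : 0 ≤ C := (norm_nonneg _).trans (hC 0)
  have t1 : Tendsto (fun n => ∫ u : ℝ, φ u * deriv (γ n) u) atTop
      (𝓝 (∫ u : ℝ, φ u * deriv g u)) := by
    refine tendsto_integral_of_dominated_convergence
      (fun u => ‖φ u * deriv g u‖ + C * ‖φ u * g u‖) ?_ (i1.norm.add (i2.norm.const_mul C)) ?_ ?_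
    · intro n
      simp only [hγd]
      exact hφ.1.mul (((hχm n).mul hdg2.1).add ((hdχm n).mul hg2.1))
    · refine fun n => ae_of_all _ fun u => ?_
      rw [hγd, mul_add]
      refine (norm_add_le _ _).trans (add_le_add ?_ ?_)
      · rw [mul_left_comm, norm_mul]
        exact mul_le_of_le_one_left (norm_nonneg _) (hχ1 _)
      · rw [mul_left_comm, norm_mul]
        refine mul_le_mul_of_nonneg_right ((hdb n u).trans ?_) (norm_nonneg _)
        exact mul_le_of_le_one_left hC0 (hε1 n)
    · refine ae_of_all _ fun u => ?_
      simp only [hγd]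
      have z : Tendsto (fun n => ((ε n * deriv χ (ε n * u) : ℝ) : ℂ)) atTop (𝓝 0) := by
        refine squeeze_zero_norm (fun n => hdb n u) ?_
        simpa using hεt.mul_const C
      simpa using (((hχlim u).mul_const (deriv g u)).add (z.mul_const (g u))).const_mul (φ u)
  have t2 : Tendsto (fun n => ∫ u : ℝ, φ' u * γ n u) atTop (𝓝 (∫ u : ℝ, φ' u * g u)) := by
    refine tendsto_integral_of_dominated_convergence (fun u => ‖φ' u * g u‖) ?_ i3.norm ?_ ?_
    · exact fun n => hφ'.1.mul ((hχm n).mul hg2.1)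
    · refine fun n => ae_of_all _ fun u => ?_
      rw [hγ]; simp only
      rw [mul_left_comm, norm_mul]
      exact mul_le_of_le_one_left (norm_nonneg _) (hχ1 _)
    · refine ae_of_all _ fun u => ?_
      simpa using ((hχlim u).mul_const (g u)).const_mul (φ' u)
  simp only [hid] at t1
  exact tendsto_nhds_unique t1 t2.neg

/-! ### Fourier duality for the characteristic function -/

theorem characteristicFunction_two_pi_mul (f : ℝ → ℝ) (v : ℝ) :
    characteristicFunction f (2 * Real.pi * v) = 𝓕 (fun x => (f x : ℂ)) (-v) := by
  rw [characteristicFunction, Real.fourier_eq']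
  refine integral_congr_ae (ae_of_all _ fun x => ?_)
  simp only [smul_eq_mul]
  rw [mul_comm]
  congr 2
  simp
  ring

/-- Multiplication formula: the characteristic function is the adjoint inverse Fourier transform. -/
theorem integral_schwartz_mul_eq_integral_fourier_mul_characteristicFunction {f : ℝ → ℝ}
    (hf : Integrable f volume) (ψ : 𝓢(ℝ, ℂ)) :
    ∫ x, ψ x * (f x : ℂ)
      = ∫ v, 𝓕 (ψ : ℝ → ℂ) v * characteristicFunction f (2 * Real.pi * v) := by
  -- Inversion writes `ψ` as the transform of the reflected `𝓕 ψ`, so self-adjointness of `𝓕` can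
  -- move the transform onto `f`.
  have hψ : (fun x => 𝓕 (fun v => 𝓕 (ψ : ℝ → ℂ) (-v)) x) = ψ := by
    have := congrArg (fun s : 𝓢(ℝ, ℂ) => (s : ℝ → ℂ)) 
      (FourierTransform.fourierInv_fourier_eq (F := 𝓢(ℝ, ℂ)) ψ)
    simp only [SchwartzMap.fourierInv_coe, SchwartzMap.fourier_coe,
      Real.fourierInv_eq_fourier_comp_neg] at this
    exact this
  have hi : Integrable (fun v => 𝓕 (ψ : ℝ → ℂ) (-v)) volume := by
    have := ((𝓕 ψ : 𝓢(ℝ, ℂ)).integrable (μ := volume)).comp_neg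
    simpa only [SchwartzMap.fourier_coe] using this
  have key := VectorFourier.integral_fourierIntegral_smul_eq_flip (μ := volume) (ν := volume)
    (L := innerₗ ℝ) (f := fun x : ℝ => (f x : ℂ)) (g := fun v => 𝓕 (ψ : ℝ → ℂ) (-v))
    Real.continuous_fourierChar continuous_inner hf.ofReal hi
  rw [flip_innerₗ] at key
  have key' : ∫ ξ, 𝓕 (fun x : ℝ => (f x : ℂ)) ξ * 𝓕 (ψ : ℝ → ℂ) (-ξ)
      = ∫ x, (f x : ℂ) * 𝓕 (fun v => 𝓕 (ψ : ℝ → ℂ) (-v)) x := key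
  rw [← integral_neg_eq_self] at key'
  simp only [neg_neg] at key'
  calc ∫ x, ψ x * (f x : ℂ) = ∫ x, (f x : ℂ) * 𝓕 (fun v => 𝓕 (ψ : ℝ → ℂ) (-v)) x := by
        refine integral_congr_ae (ae_of_all _ fun x => ?_)
        simp only [congrFun hψ x, mul_comm]
    _ = _ := by
        rw [← key']
        refine integral_congr_ae (ae_of_all _ fun v => ?_)
        simp only [characteristicFunction_two_pi_mul]
        exact mul_comm _ _

theorem memLp_two_comp_mul_left {g : ℝ → ℂ} (hg : MemLp g 2 volume) {a : ℝ} (ha : a ≠ 0) :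
    MemLp (fun v => g (a * v)) 2 volume := by
  have hm : AEStronglyMeasurable (fun v => g (a * v)) volume :=
    hg.1.comp_quasiMeasurePreserving (Measure.quasiMeasurePreserving_smul volume ha)
  rw [memLp_two_iff_integrable_sq_norm hm]
  exact ((memLp_two_iff_integrable_sq_norm hg.1).1 hg).comp_mul_left' ha

section

variable {f : ℝ → ℝ} {φ' : ℝ → ℂ}

theorem memLp_two_of_characteristicFunction (hf : Integrable f volume)
    (hφ : MemLp (characteristicFunction f) 2 volume) : MemLp f 2 volume := by
  have := memLp_two_of_integral_eq_integral_fourier hf.ofReal.locallyIntegrable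
    (memLp_two_comp_mul_left hφ Real.two_pi_pos.ne')
    (integral_schwartz_mul_eq_integral_fourier_mul_characteristicFunction hf)
  exact this.re

/-- With c(x) = 2πix, (𝓕 ψ)' = -𝓕 (c ψ). Hence ∫ ψ c f = ∫ 𝓕 (c ψ) Φ = -∫ Φ (𝓕 ψ)' = ∫ Ψ 𝓕 ψ, so c f
pairs like the transform of Ψ in L². -/
theorem memLp_two_mul_of_isWeakDerivative (hf : Integrable f volume)
    (hφ : MemLp (characteristicFunction f) 2 volume) (hφ'2 : MemLp φ' 2 volume)
    (hw : IsWeakDerivative (characteristicFunction f) φ') :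
    MemLp (fun x => x * f x) 2 volume := by
  set Φ : ℝ → ℂ := fun v => characteristicFunction f (2 * Real.pi * v) with hΦ
  set Ψ : ℝ → ℂ := fun v => ((2 * Real.pi : ℝ) : ℂ) * φ' (2 * Real.pi * v) with hΨ
  have hΦ2 : MemLp Φ 2 volume := memLp_two_comp_mul_left hφ Real.two_pi_pos.ne'
  have hΨ2 : MemLp Ψ 2 volume :=
    (memLp_two_comp_mul_left hφ'2 Real.two_pi_pos.ne').const_mul _
  set c : ℝ → ℂ := fun x => 2 * Real.pi * Complex.I * x with hc
  have hcont : Continuous c := by fun_prop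
  have hct : c.HasTemperateGrowth := by
    have : c = fun x : ℝ => (2 * Real.pi * Complex.I) * Complex.ofRealCLM x := rfl
    rw [this]; fun_prop
  have hloc : LocallyIntegrable (fun x => c x * (f x : ℂ)) volume := by
    have := hf.ofReal (𝕜 := ℂ) |>.locallyIntegrable.continuous_smul hcont
    exact this
  have main := memLp_two_of_integral_eq_integral_fourier hloc hΨ2 fun ψ => ?_
  · have := (main.const_mul (2 * Real.pi * Complex.I)⁻¹).re
    refine (memLp_congr_ae (ae_of_all _ fun x => ?_)).1 this
    have hK : (2 * Real.pi * Complex.I : ℂ) ≠ 0 := Complex.two_pi_I_ne_zero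
    have : (2 * Real.pi * Complex.I : ℂ)⁻¹ * (c x * (f x : ℂ)) = ((x * f x : ℝ) : ℂ) := by
      rw [hc, ← mul_assoc, inv_mul_cancel_left₀ hK, Complex.ofReal_mul]
    rw [this]
    exact Complex.ofReal_re _
  · set ψ₁ : 𝓢(ℝ, ℂ) := smulLeftCLM ℂ c ψ with hψ₁
    have hψ₁x : ∀ x, ψ₁ x = c x * ψ x := fun x => by
      rw [hψ₁, smulLeftCLM_apply_apply hct, smul_eq_mul]
    have hd : deriv (𝓕 ψ : 𝓢(ℝ, ℂ)) = fun v => -𝓕 (ψ₁ : ℝ → ℂ) v := by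
      have hxψ : Integrable (fun x : ℝ => x • ψ x) volume := by
        have := ((2 * Real.pi * Complex.I : ℂ)⁻¹ • ψ₁).integrable (μ := volume)
        refine this.congr (ae_of_all _ fun x => ?_)
        simp only [smul_apply, hψ₁x, hc, smul_eq_mul, Complex.real_smul]
        have : (Real.pi : ℂ) ≠ 0 := by exact_mod_cast Real.pi_ne_zero
        field_simp [Complex.I_ne_zero]
      rw [SchwartzMap.fourier_coe, Real.deriv_fourier ψ.integrable hxψ]
      funext v
      rw [Real.fourier_eq', Real.fourier_eq', ← integral_neg]
      refine integral_congr_ae (ae_of_all _ fun x => ?_)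
      simp only [smul_eq_mul, hψ₁x, hc]
      ring
    have hwd := integral_mul_deriv_eq_neg_of_schwartz hΦ2 hΨ2
      (fun g hg hgc => integral_mul_deriv_eq_neg_comp_mul_left hw.2.2 Real.two_pi_pos g hg hgc)
      (𝓕 ψ)
    have h1 := integral_schwartz_mul_eq_integral_fourier_mul_characteristicFunction hf ψ₁
    calc ∫ x, ψ x * (c x * (f x : ℂ)) = ∫ x, ψ₁ x * (f x : ℂ) := by
          simp only [hψ₁x]
          refine integral_congr_ae (ae_of_all _ fun x => ?_)
          simp only; ring
      _ = -∫ v, Φ v * deriv (𝓕 ψ : 𝓢(ℝ, ℂ)) v := by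
          rw [h1, hd, ← integral_neg]
          refine integral_congr_ae (ae_of_all _ fun v => ?_)
          simp only [hΦ]; ring
      _ = _ := by
          rw [hwd, neg_neg]
          refine integral_congr_ae (ae_of_all _ fun v => ?_)
          simp only [SchwartzMap.fourier_coe]; ring

end

/-! ### Orthogonality of the cosine modes -/

/-- The cosine `cos (kπ (x + L) / (2L))` of the COS method. -/
noncomputable def cosMode (L : ℝ) (k : ℤ) (x : ℝ) : ℝ :=
  Real.cos (k * Real.pi * ((x + L) / (2 * L)))

theorem continuous_cosMode (L : ℝ) (k : ℤ) : Continuous (cosMode L k) := by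
  unfold cosMode; fun_prop

/-- The sine primitive vanishes at both endpoints, where its argument is an integer multiple of π.
-/
theorem integral_cosMode {L : ℝ} (hL : 0 < L) {m : ℤ} (hm : m ≠ 0) (n : ℤ) :
    ∫ x in ((2 * n - 1) * L)..((2 * n + 1) * L), cosMode L m x = 0 := by
  have hm' : (m : ℝ) ≠ 0 := by exact_mod_cast hm
  have hπ := Real.pi_ne_zero
  have hd : ∀ x : ℝ, HasDerivAt
      (fun x => 2 * L / (m * Real.pi) * Real.sin (m * Real.pi * ((x + L) / (2 * L))))
      (cosMode L m x) x := by
    intro x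
    have h1 : HasDerivAt (fun x : ℝ => m * Real.pi * ((x + L) / (2 * L)))
        (m * Real.pi * (1 / (2 * L))) x :=
      (((hasDerivAt_id x).add_const L).div_const (2 * L)).const_mul _
    have h2 := h1.sin.const_mul (2 * L / (m * Real.pi))
    refine h2.congr_deriv ?_
    unfold cosMode
    field_simp
  rw [intervalIntegral.integral_eq_sub_of_hasDerivAt (fun x _ => hd x)
    ((continuous_cosMode L m).intervalIntegrable _ _)]
  have e1 : m * Real.pi * (((2 * n + 1) * L + L) / (2 * L)) = ((m * (n + 1) : ℤ) : ℝ) * Real.pi := by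
    push_cast; field_simp; ring
  have e2 : m * Real.pi * (((2 * n - 1) * L + L) / (2 * L)) = ((m * n : ℤ) : ℝ) * Real.pi := by
    push_cast; field_simp; ring
  rw [e1, e2, Real.sin_int_mul_pi, Real.sin_int_mul_pi]
  simp

theorem cosMode_mul_cosMode (L : ℝ) (j k : ℤ) (x : ℝ) :
    cosMode L j x * cosMode L k x = (cosMode L (j - k) x + cosMode L (j + k) x) / 2 := by
  unfold cosMode
  push_cast
  rw [sub_mul, sub_mul, add_mul, add_mul, Real.cos_sub, Real.cos_add]
  ring

theorem integral_cosMode_mul_cosMode_of_ne {L : ℝ} (hL : 0 < L) {j k : ℕ} (hjk : j ≠ k) (n : ℤ) :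
    ∫ x in ((2 * n - 1) * L)..((2 * n + 1) * L), cosMode L j x * cosMode L k x = 0 := by
  simp only [cosMode_mul_cosMode]
  rw [intervalIntegral.integral_div, intervalIntegral.integral_add
    ((continuous_cosMode _ _).intervalIntegrable _ _)
    ((continuous_cosMode _ _).intervalIntegrable _ _),
    -- Both frequencies `j - k` and `j + k` are nonzero because `j` and `k` are distinct naturals.
    integral_cosMode hL (by omega), integral_cosMode hL (by omega)]
  simp

theorem integral_cosMode_mul_self_le {L : ℝ} (hL : 0 < L) (k n : ℤ) :
    ∫ x in ((2 * n - 1) * L)..((2 * n + 1) * L), cosMode L k x * cosMode L k x ≤ 2 * L := by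
  have hle : (2 * n - 1) * L ≤ (2 * n + 1) * L := by nlinarith
  have := intervalIntegral.integral_mono_on (μ := volume) (f := fun x => cosMode L k x * cosMode L k x)
    (g := fun _ => (1 : ℝ)) hle
    (((continuous_cosMode L k).mul (continuous_cosMode L k)).intervalIntegrable _ _)
    (continuous_const.intervalIntegrable _ _) (fun x _ => by
      have := Real.cos_sq_le_one (k * Real.pi * ((x + L) / (2 * L)))
      rw [sq] at this
      exact this)
  refine this.trans (le_of_eq ?_)
  simp; ring

/-- Bessel-type bound for cosine sums on each translate of `[-L, L]` by a multiple of `2L`. -/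
theorem integral_sum_cosMode_sq_le {L : ℝ} (hL : 0 < L) (a : ℕ → ℝ) (K : ℕ) (n : ℤ) :
    ∫ x in ((2 * n - 1) * L)..((2 * n + 1) * L),
      (∑ k ∈ Finset.range K, a k * cosMode L k x) ^ 2
      ≤ 2 * L * ∑ k ∈ Finset.range K, a k ^ 2 := by
  have hi : ∀ (c : ℝ) (j k : ℕ), IntervalIntegrable
      (fun x => c * (cosMode L j x * cosMode L k x)) volume
      ((2 * n - 1) * L) ((2 * n + 1) * L) := fun c j k =>
    (continuous_const.mul
      ((continuous_cosMode L j).mul (continuous_cosMode L k))).intervalIntegrable _ _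
  have e : ∀ x, (∑ k ∈ Finset.range K, a k * cosMode L k x) ^ 2
      = ∑ j ∈ Finset.range K, ∑ k ∈ Finset.range K,
        (a j * a k) * (cosMode L j x * cosMode L k x) := by
    intro x
    rw [sq, Finset.sum_mul_sum]
    refine Finset.sum_congr rfl fun j _ => Finset.sum_congr rfl fun k _ => by ring
  simp only [e]
  have hsum : ∀ j : ℕ, IntervalIntegrable
      (fun x => ∑ k ∈ Finset.range K, (a j * a k) * (cosMode L j x * cosMode L k x)) volume
      ((2 * n - 1) * L) ((2 * n + 1) * L) := fun j =>
    (continuous_finsetSum _ fun k _ => show Continuous fun x =>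
      (a j * a k) * (cosMode L j x * cosMode L k x) from continuous_const.mul
      ((continuous_cosMode L j).mul (continuous_cosMode L k))).intervalIntegrable _ _
  rw [intervalIntegral.integral_finsetSum fun j _ => hsum j, Finset.mul_sum]
  refine Finset.sum_le_sum fun j hj => ?_
  rw [intervalIntegral.integral_finsetSum fun k _ => hi _ j k,
    Finset.sum_eq_single_of_mem j hj]
  · rw [intervalIntegral.integral_const_mul, mul_comm (2 * L), sq]
    exact mul_le_mul_of_nonneg_left (integral_cosMode_mul_self_le hL j n) (mul_self_nonneg _)
  · intro k _ hk
    rw [intervalIntegral.integral_const_mul, integral_cosMode_mul_cosMode_of_ne hL hk.symm,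
      mul_zero]

/-! ### Weighted bound on the tail -/

/-- The tail of `ℝ` outside `[-L, L]` is covered by the translates of `(-L, L]` by nonzero
multiples of `2L`. -/
theorem compl_Icc_subset_iUnion {L : ℝ} (hL : 0 < L) :
    (Set.Icc (-L) L)ᶜ
      ⊆ ⋃ n : ℤ, (Set.Icc (-L) L)ᶜ ∩ Set.Ioc ((2 * n - 1) * L) ((2 * n + 1) * L) := by
  intro x hx
  -- This is the unique integer n with (2n - 1) L < x ≤ (2n + 1) L.
  refine Set.mem_iUnion.2 ⟨⌈(x / L - 1) / 2⌉, hx, ?_, ?_⟩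
  · have := Int.ceil_lt_add_one ((x / L - 1) / 2)
    rw [← lt_div_iff₀ hL]; linarith
  · have := Int.le_ceil ((x / L - 1) / 2)
    rw [← div_le_iff₀ hL]; linarith

/-- The piece n = 0 is empty; otherwise |x| ≥ (2|n| - 1) L ≥ |n| L. -/
theorem mul_sq_le_sq_of_mem {L x : ℝ} (hL : 0 < L) {n : ℤ}
    (hx : x ∈ (Set.Icc (-L) L)ᶜ ∩ Set.Ioc ((2 * n - 1) * L) ((2 * n + 1) * L)) :
    n ≠ 0 ∧ (n : ℝ) ^ 2 * L ^ 2 ≤ x ^ 2 := by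
  obtain ⟨h1, h2, h3⟩ := hx
  rcases lt_trichotomy n 0 with hn | hn | hn
  · have : (n : ℝ) ≤ -1 := by exact_mod_cast Int.le_sub_one_of_lt hn
    refine ⟨hn.ne, ?_⟩
    rw [← mul_pow]
    exact sq_le_sq.2 (by
      rw [abs_of_nonpos (by nlinarith), abs_of_nonpos (by nlinarith)]; nlinarith)
  · subst hn
    refine absurd ⟨?_, ?_⟩ h1
    · push_cast at h2; linarith
    · push_cast at h3; linarith
  · have : (1 : ℝ) ≤ n := by exact_mod_cast hn
    refine ⟨hn.ne', ?_⟩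
    rw [← mul_pow]
    exact sq_le_sq.2 (by
      rw [abs_of_nonneg (by nlinarith), abs_of_nonneg (by nlinarith)]; nlinarith)

/-- Weighted `L²` bound for cosine sums on the tail. -/
theorem lintegral_sum_cosMode_sq_div_le {L : ℝ} (hL : 0 < L) (a : ℕ → ℝ) (K : ℕ) :
    ∫⁻ x in (Set.Icc (-L) L)ᶜ,
      ENNReal.ofReal ((∑ k ∈ Finset.range K, a k * cosMode L k x) ^ 2 / x ^ 2)
      ≤ ENNReal.ofReal (2 * (∑' n : ℤ, 1 / (n : ℝ) ^ 2) * (∑ k ∈ Finset.range K, a k ^ 2) / L) := by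
  set S := ∑ k ∈ Finset.range K, a k ^ 2 with hS
  set T : ℝ → ℝ := fun x => ∑ k ∈ Finset.range K, a k * cosMode L k x with hT
  have hTc : Continuous T :=
    continuous_finsetSum _ fun k _ => continuous_const.mul (continuous_cosMode L k)
  have hT2 : Continuous fun x => T x ^ 2 := hTc.pow 2
  have hS0 : 0 ≤ S := Finset.sum_nonneg fun k _ => sq_nonneg _
  have hZ : Summable fun n : ℤ => 1 / (n : ℝ) ^ 2 :=
    Real.summable_one_div_int_pow.2 one_lt_two
  -- For n = 0 both sides are zero: the piece is empty, and `1 / 0 ^ 2 = 0`.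
  have hpiece : ∀ n : ℤ,
      ∫⁻ x in (Set.Icc (-L) L)ᶜ ∩ Set.Ioc ((2 * n - 1) * L) ((2 * n + 1) * L),
        ENNReal.ofReal (T x ^ 2 / x ^ 2) ≤ ENNReal.ofReal (1 / (n : ℝ) ^ 2 * (2 * S / L)) := by
    intro n
    have hle : (2 * n - 1) * L ≤ (2 * n + 1) * L := by nlinarith
    have hms : MeasurableSet ((Set.Icc (-L) L)ᶜ ∩ Set.Ioc ((2 * n - 1) * L) ((2 * n + 1) * L)) :=
      measurableSet_Icc.compl.inter measurableSet_Ioc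
    calc _ ≤ ∫⁻ x in (Set.Icc (-L) L)ᶜ ∩ Set.Ioc ((2 * n - 1) * L) ((2 * n + 1) * L),
          ENNReal.ofReal (1 / ((n : ℝ) ^ 2 * L ^ 2)) * ENNReal.ofReal (T x ^ 2) := by
          refine setLIntegral_mono' hms fun x hx => ?_
          obtain ⟨hn, hle⟩ := mul_sq_le_sq_of_mem hL hx
          rw [← ENNReal.ofReal_mul (by positivity)]
          refine ENNReal.ofReal_le_ofReal ?_
          rw [div_eq_mul_one_div, mul_comm]
          have hn' : (n : ℝ) ≠ 0 := by exact_mod_cast hn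
          exact mul_le_mul_of_nonneg_right
            (one_div_le_one_div_of_le (by positivity) hle) (sq_nonneg _)
      _ ≤ ∫⁻ x in Set.Ioc ((2 * n - 1) * L) ((2 * n + 1) * L),
          ENNReal.ofReal (1 / ((n : ℝ) ^ 2 * L ^ 2)) * ENNReal.ofReal (T x ^ 2) :=
          lintegral_mono_set Set.inter_subset_right
      _ = ENNReal.ofReal (1 / ((n : ℝ) ^ 2 * L ^ 2)) *
          ENNReal.ofReal (∫ x in ((2 * n - 1) * L)..((2 * n + 1) * L), T x ^ 2) := by
          rw [lintegral_const_mul' _ _ ENNReal.ofReal_ne_top,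
            intervalIntegral.integral_of_le hle, ofReal_integral_eq_lintegral_ofReal
              (hT2.intervalIntegrable _ _).1 (ae_of_all _ fun x => sq_nonneg _)]
      _ ≤ ENNReal.ofReal (1 / ((n : ℝ) ^ 2 * L ^ 2)) * ENNReal.ofReal (2 * L * S) := by
          gcongr
          exact integral_sum_cosMode_sq_le hL a K n
      _ = _ := by
          rw [← ENNReal.ofReal_mul (by positivity)]
          congr 1
          rw [one_div, mul_inv, one_div]
          field_simp
  calc _ ≤ ∫⁻ x in ⋃ n : ℤ, (Set.Icc (-L) L)ᶜ ∩ Set.Ioc ((2 * n - 1) * L) ((2 * n + 1) * L),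
        ENNReal.ofReal (T x ^ 2 / x ^ 2) := lintegral_mono_set (compl_Icc_subset_iUnion hL)
    _ ≤ ∑' n : ℤ, ENNReal.ofReal (1 / (n : ℝ) ^ 2 * (2 * S / L)) :=
        (lintegral_iUnion_le _ _).trans (ENNReal.tsum_le_tsum hpiece)
    _ = _ := by
        rw [← ENNReal.ofReal_tsum_of_nonneg (fun n => by positivity) (hZ.mul_right _),
          tsum_mul_right]
        congr 1; ring

/-! ### Tail estimate and conclusion -/

/-- Quantitative tail estimate in terms of the second moment `∫ x² f²`. -/
theorem cosTail_le {f : ℝ → ℝ} (hf : Integrable f volume)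
    (hxf : MemLp (fun x => x * f x) 2 volume) {L : ℝ} (hL : 0 < L) :
    cosTail f L ≤ ENNReal.ofReal
      (2 * (1 + ∑' n : ℤ, 1 / (n : ℝ) ^ 2) * (∫ x, (x * f x) ^ 2) / L ^ 2) := by
  set Z₀ : ℝ := ∑' n : ℤ, 1 / (n : ℝ) ^ 2 with hZ₀
  have hZ₀0 : 0 ≤ Z₀ := tsum_nonneg fun n => by positivity
  -- The added 1 makes positivity of `Z` immediate and keeps `Z₀ / Z ≤ 1`.
  set Z : ℝ := 1 + Z₀ with hZ
  have hZ0 : 0 < Z := by positivity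
  set M : ℝ := ∫ x, (x * f x) ^ 2 with hM
  have hM0 : 0 ≤ M := integral_nonneg fun x => sq_nonneg _
  set a : ℕ → ℝ := fun k => ∫ x in (Set.Icc (-L) L)ᶜ, f x * cosMode L k x with ha
  have hfi : ∀ k : ℕ, IntegrableOn (fun x => f x * cosMode L k x) (Set.Icc (-L) L)ᶜ := fun k =>
    (hf.mul_bdd (c := 1) (continuous_cosMode L k).aestronglyMeasurable
      (ae_of_all _ fun x => Real.abs_cos_le_one _)).integrableOn
  have bound : ∀ K : ℕ, ∑ k ∈ Finset.range K, a k ^ 2 ≤ 2 * Z * M / L := by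
    intro K
    set S := ∑ k ∈ Finset.range K, a k ^ 2 with hS
    have hS0 : 0 ≤ S := Finset.sum_nonneg fun k _ => sq_nonneg _
    set T : ℝ → ℝ := fun x => ∑ k ∈ Finset.range K, a k * cosMode L k x with hT
    have hST : S = ∫ x in (Set.Icc (-L) L)ᶜ, f x * T x := by
      have : ∀ x, f x * T x = ∑ k ∈ Finset.range K, a k * (f x * cosMode L k x) := fun x => by
        rw [hT, Finset.mul_sum]
        exact Finset.sum_congr rfl fun k _ => by ring
      simp only [this]
      rw [integral_finsetSum _ fun k _ => (hfi k).const_mul _]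
      refine Finset.sum_congr rfl fun k _ => ?_
      rw [integral_const_mul, sq]
    -- Young weight chosen so that the T² / x² term is at most `S / 2`, leaving `S / 2 ≤ Z * M / L`.
    set s : ℝ := 2 * Z / L with hs
    have hs0 : 0 < s := by positivity
    have h1 : ENNReal.ofReal S ≤ ∫⁻ x in (Set.Icc (-L) L)ᶜ,
        (ENNReal.ofReal (s / 2) * ENNReal.ofReal ((x * f x) ^ 2)
          + ENNReal.ofReal (1 / (2 * s)) * ENNReal.ofReal (T x ^ 2 / x ^ 2)) := by
      rw [← Real.enorm_of_nonneg hS0, hST]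
      refine (enorm_integral_le_lintegral_enorm _).trans ?_
      refine setLIntegral_mono' measurableSet_Icc.compl fun x hx => ?_
      have hx0 : x ≠ 0 := by
        rintro rfl
        exact hx ⟨by linarith, hL.le⟩
      rw [← ofReal_norm, ← ENNReal.ofReal_mul (by positivity),
        ← ENNReal.ofReal_mul (by positivity), ← ENNReal.ofReal_add (by positivity) (by positivity)]
      refine ENNReal.ofReal_le_ofReal ?_
      have e : f x * T x = (x * f x) * (T x / x) := by field_simp
      rw [e, ← div_pow, Real.norm_eq_abs, abs_mul, ← sq_abs (x * f x), ← sq_abs (T x / x)]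
      generalize |x * f x| = p
      generalize |T x / x| = q
      have : s / 2 * p ^ 2 + 1 / (2 * s) * q ^ 2 - p * q = (s * p - q) ^ 2 / (2 * s) := by
        field_simp; ring
      have : 0 ≤ (s * p - q) ^ 2 / (2 * s) := by positivity
      linarith
    have hxm : AEMeasurable (fun x => ENNReal.ofReal (s / 2) * ENNReal.ofReal ((x * f x) ^ 2))
        (volume.restrict (Set.Icc (-L) L)ᶜ) :=
      ((hxf.1.aemeasurable.pow_const 2).ennreal_ofReal.const_mul _).restrict
    rw [lintegral_add_left' hxm, lintegral_const_mul' _ _ ENNReal.ofReal_ne_top,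
      lintegral_const_mul' _ _ ENNReal.ofReal_ne_top] at h1
    have h2 : ∫⁻ x in (Set.Icc (-L) L)ᶜ, ENNReal.ofReal ((x * f x) ^ 2) ≤ ENNReal.ofReal M := by
      rw [hM, ofReal_integral_eq_lintegral_ofReal
        ((memLp_two_iff_integrable_sq hxf.1).1 hxf) (ae_of_all _ fun x => sq_nonneg _)]
      exact setLIntegral_le_lintegral _ _
    have h3 := h1.trans (add_le_add (mul_le_mul_right h2 _)
      (mul_le_mul_right (lintegral_sum_cosMode_sq_div_le hL a K) _))
    rw [← ENNReal.ofReal_mul (by positivity), ← ENNReal.ofReal_mul (by positivity),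
      ← ENNReal.ofReal_add (by positivity) (by positivity),
      ENNReal.ofReal_le_ofReal_iff (by positivity)] at h3
    have h4 : 1 / (2 * s) * (2 * Z₀ * S / L) ≤ S / 2 := by
      have : 1 / (2 * s) * (2 * Z₀ * S / L) = Z₀ / Z * (S / 2) := by
        rw [hs]; field_simp
      rw [this]
      refine mul_le_of_le_one_left (by positivity) ?_
      rw [div_le_one hZ0]; linarith
    have h5 : s / 2 * M = Z * M / L := by rw [hs]; ring
    have h6 : 2 * Z * M / L = 2 * (Z * M / L) := by ring
    linarith
  refine ENNReal.tsum_le_of_sum_range_le fun K => ?_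
  have hterm : ∀ k : ℕ, 1 / L * |∫ x in (Set.Icc (-L) L)ᶜ,
      f x * Real.cos (k * Real.pi * ((x + L) / (2 * L)))| ^ 2 = 1 / L * a k ^ 2 := fun k => by
    rw [sq_abs]; simp [ha, cosMode]
  simp only [hterm]
  rw [← ENNReal.ofReal_sum_of_nonneg fun k _ => by positivity, ← Finset.mul_sum]
  refine ENNReal.ofReal_le_ofReal ?_
  calc 1 / L * ∑ k ∈ Finset.range K, a k ^ 2 ≤ 1 / L * (2 * Z * M / L) := by
        gcongr; exact bound K
    _ = _ := by field_simp

theorem tendsto_cosTail {f : ℝ → ℝ} (hf : Integrable f volume)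
    (hxf : MemLp (fun x => x * f x) 2 volume) : Tendsto (cosTail f) atTop (𝓝 0) := by
  set C : ℝ := 2 * (1 + ∑' n : ℤ, 1 / (n : ℝ) ^ 2) * (∫ x, (x * f x) ^ 2) with hC
  have ht : Tendsto (fun L : ℝ => ENNReal.ofReal (C / L ^ 2)) atTop (𝓝 0) := by
    have : Tendsto (fun L : ℝ => C / L ^ 2) atTop (𝓝 0) :=
      tendsto_const_nhds.div_atTop (tendsto_pow_atTop two_ne_zero)
    simpa using ENNReal.tendsto_ofReal this
  refine tendsto_of_tendsto_of_tendsto_of_le_of_le' tendsto_const_nhds ht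
    (Eventually.of_forall fun _ => zero_le) ?_
  filter_upwards [eventually_gt_atTop 0] with L hL
  exact cosTail_le hf hxf hL

theorem mainTheorem6 (f : ℝ → ℝ) (hf : Integrable f volume) (φ' : ℝ → ℂ)
    (hφ' : IsWeakDerivative (characteristicFunction f) φ')
    (hL : Integrable (fun u : ℝ => ‖characteristicFunction f u‖ ^ 2 + ‖φ' u‖ ^ 2) volume) :
    MemLp f 2 volume ∧ MemLp (fun x : ℝ => x * f x) 2 volume ∧ COSAdmissible f := by
  have hm := hφ'.1.aestronglyMeasurable
  have hm' := hφ'.2.1.aestronglyMeasurable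
  have hφ2 : MemLp (characteristicFunction f) 2 volume :=
    (memLp_two_iff_integrable_sq_norm hm).2 <| hL.mono' (hm.norm.pow 2) <| ae_of_all _ fun u => by
      rw [Real.norm_of_nonneg (sq_nonneg _)]
      exact le_add_of_nonneg_right (sq_nonneg _)
  have hφ'2 : MemLp φ' 2 volume :=
    (memLp_two_iff_integrable_sq_norm hm').2 <| hL.mono' (hm'.norm.pow 2) <| ae_of_all _ fun u => by
      rw [Real.norm_of_nonneg (sq_nonneg _)]
      exact le_add_of_nonneg_left (sq_nonneg _)
  have hxf := memLp_two_mul_of_isWeakDerivative hf hφ2 hφ'2 hφ'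
  exact ⟨memLp_two_of_characteristicFunction hf hφ2, hxf, hf, tendsto_cosTail hf hxf⟩
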